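/- Let $X$ be an abstract (reduced) complex analytic variety of finite dimension $n$: a Hausdorff, second countable space with a covering by open sets $A_l$ and homeomorphisms $F_l:A_l\to W_l$ onto holomorphic (closed) subvarieties $W_l$ of open sets $U_l\subseteq\mathbb C^{n_l}$, with biholomorphic coordinate changes, whose regular part $X'$ is an $n$-dimensional complex manifold. An atlas of $X$ is a covering of $X$ by domains of charts of the maximal atlas. A function on $X$ is holomorphic (resp. smooth) if locally, in charts, it extends to a holomorphic (resp. $C^\infty$) function on an open subset of the ambient $\mathbb C^{n_l}$; $\mathcal O_X$ and $\mathcal C^\infty_X$ denote the sheaves of complex valued holomorphic and smooth functions. (a) Let $\mathcal B=\{(B_\beta,n_\beta,U_\beta,W_\beta,F_\beta)\}_{\beta\in\mathfrak B}$ be an atlas of $X$ such that for every $\beta\in\mathfrak B$ there are only finitely many $\gamma\in\mathfrak B$ with $\overline{B_\gamma}\cap B_\beta\neq\emptyset$. Then there is a partition of unity $\{\rho_\beta:X\to\mathbb R\}_{\beta\in\mathfrak B}$ subordinate to $\mathcal B$ such that for all $\beta,\gamma\in\mathfrak B$ (in particular for $\gamma=\beta$) the function $\rho_\beta\circ F_\gamma^{-1}:W_\gamma\to\mathbb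 R$ extends to a $C^\infty$ function $U_\gamma\to\mathbb R$. Moreover each $\rho_\beta|_{X'}$ is an extendable $0$-form, i.e. $\rho_\beta|_{X'}\otimes 1$ is the restriction to $X'$ of a global section of the sheaf $\mathcal S_0$ defined below. (b) Let $\Omega_X$ be the sheaf of holomorphic differentials of $X$ (in a chart, $\Omega_{U}/(I\,\Omega_{U}+\mathcal O_{U}\,dI)$ with $I$ the ideal sheaf of the subvariety), $\Omega_X^p=\Lambda^p\Omega_X$, and $\mathcal O_X(\mathbf TX)$ the sheaf of holomorphic vector fields, i.e. of $\mathbb C$-derivations of $\mathcal O_X$. Then for all $N,N^*,p\in\mathbb N$ the sheaves $$\mathcal S_{N,N^*}=\bigl(\Omega_X^{\otimes N}\otimes_{\mathcal O_X}\mathcal O_X(\mathbf TX)^{\otimes N^*}\bigr)\otimes_{\mathcal O_X}\mathcal C_X^\infty\quad\text{and}\quad \mathcal S_p=\Omega_X^p\otimes_{\mathcal O_X}\mathcal C_X^\infty$$ are fine (for every locally finite open covering $\{V_i\}$ of $X$ there are sheaf endomorphisms $\eta_i$ with support in $V_i$ and $\sum_i\eta_i=1$) and soft (every section over a closed subset of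 $X$ extends to a global section). -/

import Mathlib

open scoped Topology ContDiff TensorProduct
open TopologicalSpace Opposite

universe u

/-! ### Analytic subvarieties of open sets and local models -/

/-- `W` is a holomorphic (closed, reduced) subvariety of the open set `U ⊆ ℂᵐ`: near every point of
`U` it is the common zero set of finitely many holomorphic functions. -/
def IsHolomorphicSubvariety {m : ℕ} (U : Opens (Fin m → ℂ)) (W : Set (Fin m → ℂ)) : Prop :=
  W ⊆ U ∧ ∀ z ∈ U, ∃ V : Opens (Fin m → ℂ), z ∈ V ∧ ∃ (k : ℕ) (f : Fin k → (Fin m → ℂ) → ℂ),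
    (∀ j, AnalyticOnNhd ℂ (f j) V) ∧ W ∩ V = {w | w ∈ V ∧ ∀ j, f j w = 0}

/-- A local chart `(A, m, U, W, F)` of a space `X`: an open set `A ⊆ X` with a homeomorphism
`F : A → W` onto a holomorphic subvariety `W` of an open set `U ⊆ ℂᵐ`. -/
structure AnalyticChart (X : Type u) [TopologicalSpace X] where
  A : Opens X
  m : ℕ
  U : Opens (Fin m → ℂ)
  W : Set (Fin m → ℂ)
  isSubvariety : IsHolomorphicSubvariety U W
  F : A ≃ₜ W

namespace AnalyticChart

variable {X : Type u} [TopologicalSpace X]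

/-- The coordinate change from the chart `d` to the chart `c` is holomorphic: near every point of
the overlap it is the restriction of a holomorphic map of the ambient spaces. -/
def HolomorphicTransition (c d : AnalyticChart X) : Prop :=
  ∀ (x : X) (_ : x ∈ c.A) (hd : x ∈ d.A), ∃ G : (Fin d.m → ℂ) → (Fin c.m → ℂ),
    AnalyticAt ℂ G (d.F ⟨x, hd⟩) ∧
      ∀ᶠ y in 𝓝 x, ∀ (hyc : y ∈ c.A) (hyd : y ∈ d.A), G (d.F ⟨y, hyd⟩) = c.F ⟨y, hyc⟩

/-- Two charts are compatible if the coordinate change is biholomorphic. -/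
def Compatible (c d : AnalyticChart X) : Prop :=
  c.HolomorphicTransition d ∧ d.HolomorphicTransition c

end AnalyticChart

/-- An (abstract, reduced) complex analytic variety structure of dimension `n` on a topological
space `X`: a system of pairwise compatible charts covering `X` such that the regular part, i.e. the
part of `X` with charts onto open sets of some `ℂᵐ`, is a manifold of dimension `n`. The space `X`
is moreover required to be Hausdorff and second countable where such structures are used. -/
structure AnalyticVariety (n : ℕ) (X : Type u) [TopologicalSpace X] where
  charts : Set (AnalyticChart X)
  cover : ∀ x : X, ∃ c ∈ charts, x ∈ c.A
  compatible : ∀ c ∈ charts, ∀ d ∈ charts, c.Compatible d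
  dim_regular : ∀ c : AnalyticChart X, (∀ d ∈ charts, c.Compatible d) → IsOpen c.W →
    (c.A : Set X).Nonempty → c.m = n

/-! ### Algebra of germs of functions -/

/-- Germs of complex valued functions form a `ℂ`-algebra. -/
instance germComplexAlgebra {α : Type*} (l : Filter α) : Algebra ℂ (l.Germ ℂ) :=
  Algebra.ofModule
    (fun r a b => by
      induction a using Filter.Germ.inductionOn with | _ f
      induction b using Filter.Germ.inductionOn with | _ g
      exact congrArg _ (funext fun x => by simp [mul_assoc]))
    (fun r a b => by
      induction a using Filter.Germ.inductionOn with | _ f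
      induction b using Filter.Germ.inductionOn with | _ g
      exact congrArg _ (funext fun x => by simp [mul_left_comm]))

namespace AnalyticVariety

variable {n : ℕ} {X : Type u} [TopologicalSpace X] (𝒳 : AnalyticVariety n X)

/-- The maximal atlas: all charts compatible with the given ones. -/
def maximalAtlas : Set (AnalyticChart X) := {c | ∀ d ∈ 𝒳.charts, c.Compatible d}

/-- An atlas of `𝒳`: a family of charts in the maximal atlas whose domains cover `X`. -/
def IsAtlas {ι : Type*} (B : ι → AnalyticChart X) : Prop :=
  (∀ i, B i ∈ 𝒳.maximalAtlas) ∧ ∀ x : X, ∃ i, x ∈ (B i).A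

/-- The regular part `X'` of `𝒳`. -/
def regularPart : Opens X where
  carrier := {x | ∃ c ∈ 𝒳.maximalAtlas, IsOpen c.W ∧ x ∈ c.A}
  is_open' := isOpen_iff_mem_nhds.2 fun _ ⟨c, hc, hW, hx⟩ =>
    Filter.mem_of_superset (c.A.isOpen.mem_nhds hx) fun _ hy => ⟨c, hc, hW, hy⟩

/-- `f` is differentiable (i.e. smooth, `C^∞` in the real sense) around `x`: in each chart it
extends to a smooth function on a neighbourhood in the ambient space. -/
def SmoothAt (f : X → ℂ) (x : X) : Prop :=
  ∀ c ∈ 𝒳.charts, ∀ hx : x ∈ c.A, ∃ (V : Opens (Fin c.m → ℂ)) (G : (Fin c.m → ℂ) → ℂ),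
    (c.F ⟨x, hx⟩ : Fin c.m → ℂ) ∈ V ∧ ContDiffOn ℝ ∞ G V ∧
      ∀ᶠ y in 𝓝 x, ∀ hy : y ∈ c.A, f y = G (c.F ⟨y, hy⟩)

/-- `f` is holomorphic around `x`: in each chart it extends to a holomorphic function on a
neighbourhood in the ambient space. -/
def HolomorphicAt (f : X → ℂ) (x : X) : Prop :=
  ∀ c ∈ 𝒳.charts, ∀ hx : x ∈ c.A, ∃ G : (Fin c.m → ℂ) → ℂ, AnalyticAt ℂ G (c.F ⟨x, hx⟩) ∧
    ∀ᶠ y in 𝓝 x, ∀ hy : y ∈ c.A, f y = G (c.F ⟨y, hy⟩)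

variable {𝒳}

theorem HolomorphicAt.smoothAt {f : X → ℂ} {x : X} (h : 𝒳.HolomorphicAt f x) :
    𝒳.SmoothAt f x := by
  intro c hc hx
  obtain ⟨G, hG, hf⟩ := h c hc hx
  obtain ⟨V, hV, hVo, hxV⟩ := eventually_nhds_iff.1 hG.eventually_analyticAt
  refine ⟨⟨V, hVo⟩, G, hxV, ?_, hf⟩
  intro z hz
  exact ((hV z hz).contDiffAt.restrict_scalars ℝ).contDiffWithinAt

variable (𝒳)

/-- The local ring `𝒪_{X,x}` of germs of holomorphic functions at `x`. -/
def O (x : X) : Subalgebra ℂ ((𝓝 x).Germ ℂ) where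
  carrier := {φ | ∃ f : X → ℂ, 𝒳.HolomorphicAt f x ∧ (f : (𝓝 x).Germ ℂ) = φ}
  mul_mem' := by
    rintro _ _ ⟨f, hf, rfl⟩ ⟨g, hg, rfl⟩
    refine ⟨f * g, fun c hc hx => ?_, rfl⟩
    obtain ⟨G, hG, hfG⟩ := hf c hc hx
    obtain ⟨H, hH, hgH⟩ := hg c hc hx
    refine ⟨G * H, hG.mul hH, ?_⟩
    filter_upwards [hfG, hgH] with y h1 h2 hy
    simp [h1 hy, h2 hy]
  add_mem' := by
    rintro _ _ ⟨f, hf, rfl⟩ ⟨g, hg, rfl⟩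
    refine ⟨f + g, fun c hc hx => ?_, rfl⟩
    obtain ⟨G, hG, hfG⟩ := hf c hc hx
    obtain ⟨H, hH, hgH⟩ := hg c hc hx
    refine ⟨G + H, hG.add hH, ?_⟩
    filter_upwards [hfG, hgH] with y h1 h2 hy
    simp [h1 hy, h2 hy]
  algebraMap_mem' r :=
    ⟨fun _ => r, fun _ _ _ => ⟨fun _ => r, analyticAt_const, by simp⟩, by
      rw [Algebra.algebraMap_eq_smul_one]
      exact congrArg _ (funext fun x => by simp)⟩

/-- The stalk `𝒞^∞_{X,x}` of germs of (complex valued) smooth functions at `x`. -/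
def C (x : X) : Subalgebra ℂ ((𝓝 x).Germ ℂ) where
  carrier := {φ | ∃ f : X → ℂ, 𝒳.SmoothAt f x ∧ (f : (𝓝 x).Germ ℂ) = φ}
  mul_mem' := by
    rintro _ _ ⟨f, hf, rfl⟩ ⟨g, hg, rfl⟩
    refine ⟨f * g, fun c hc hx => ?_, rfl⟩
    obtain ⟨V, G, hV, hG, hfG⟩ := hf c hc hx
    obtain ⟨V', H, hV', hH, hgH⟩ := hg c hc hx
    refine ⟨V ⊓ V', G * H, ⟨hV, hV'⟩, (hG.mono fun _ h => h.1).mul (hH.mono fun _ h => h.2), ?_⟩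
    filter_upwards [hfG, hgH] with y h1 h2 hy
    simp [h1 hy, h2 hy]
  add_mem' := by
    rintro _ _ ⟨f, hf, rfl⟩ ⟨g, hg, rfl⟩
    refine ⟨f + g, fun c hc hx => ?_, rfl⟩
    obtain ⟨V, G, hV, hG, hfG⟩ := hf c hc hx
    obtain ⟨V', H, hV', hH, hgH⟩ := hg c hc hx
    refine ⟨V ⊓ V', G + H, ⟨hV, hV'⟩, (hG.mono fun _ h => h.1).add (hH.mono fun _ h => h.2), ?_⟩
    filter_upwards [hfG, hgH] with y h1 h2 hy
    simp [h1 hy, h2 hy]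
  algebraMap_mem' r :=
    ⟨fun _ => r, fun _ _ _ => ⟨⊤, fun _ => r, trivial, contDiffOn_const, by simp⟩, by
      rw [Algebra.algebraMap_eq_smul_one]
      exact congrArg _ (funext fun x => by simp)⟩

variable {𝒳}

/-- The germ at `x` of a function that is holomorphic around `x`. -/
def holGerm (f : X → ℂ) {x : X} (h : 𝒳.HolomorphicAt f x) : 𝒳.O x := ⟨f, f, h, rfl⟩

/-- The germ at `x` of a function that is smooth around `x`. -/
def smoothGerm (f : X → ℂ) {x : X} (h : 𝒳.SmoothAt f x) : 𝒳.C x := ⟨f, f, h, rfl⟩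

variable (𝒳)

theorem O_le_C (x : X) : 𝒳.O x ≤ 𝒳.C x := fun _ ⟨f, hf, h⟩ => ⟨f, hf.smoothAt, h⟩

/-- Smooth germs form an algebra over holomorphic germs, through the inclusion. -/
instance algebraOC (x : X) : Algebra (𝒳.O x) (𝒳.C x) :=
  (Subalgebra.inclusion (𝒳.O_le_C x)).toRingHom.toAlgebra

/-! ### Holomorphic differentials and holomorphic vector fields -/

noncomputable section

/-- The relations that make the differential of functions on `X` obey the chain rule for all
holomorphic functions of several variables: if `h = Φ(g₁, …, g_k)` for a holomorphic `Φ`, then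
`dh = ∑ⱼ (∂ⱼΦ)(g₁, …, g_k) dgⱼ`. -/
def chainRelations (x : X) : Submodule (𝒳.O x) (Ω[𝒳.O x⁄ℂ]) :=
  Submodule.span (𝒳.O x) {τ | ∃ (k : ℕ) (Φ : (Fin k → ℂ) → ℂ) (f : Fin k → X → ℂ)
    (g : Fin k → 𝒳.O x) (h : 𝒳.O x) (h' : Fin k → 𝒳.O x),
    (∀ j, (f j : (𝓝 x).Germ ℂ) = g j) ∧ AnalyticAt ℂ Φ (fun j => f j x) ∧
    (h : (𝓝 x).Germ ℂ) = ((fun y => Φ fun i => f i y : X → ℂ) : (𝓝 x).Germ ℂ) ∧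
    (∀ j, (h' j : (𝓝 x).Germ ℂ) =
      ((fun y => fderiv ℂ Φ (fun i => f i y) (Pi.single j 1) : X → ℂ) : (𝓝 x).Germ ℂ)) ∧
    τ = KaehlerDifferential.D ℂ (𝒳.O x) h - ∑ j, h' j • KaehlerDifferential.D ℂ (𝒳.O x) (g j)}

/-- The stalk `Ω_{X,x}` of germs of holomorphic differentials: symbols `dg` for `g ∈ 𝒪_{X,x}`,
subject to linearity, the Leibniz rule and the holomorphic chain rule. In a chart with coordinates
`z₁, …, z_m` and ideal `I` of the subvariety this is the free `𝒪_{X,x}`-module on `dz₁, …, dz_m`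
modulo the differentials `∑ ∂f/∂zᵢ dzᵢ` of the `f ∈ I`, i.e. the stalk of the usual coherent sheaf
`Ω_U / (I Ω_U + 𝒪_U dI)`. -/
abbrev Omega (x : X) : Type u := Ω[𝒳.O x⁄ℂ] ⧸ 𝒳.chainRelations x

/-- The differential `dg` of a holomorphic germ. -/
def dGerm {x : X} (g : 𝒳.O x) : 𝒳.Omega x :=
  (𝒳.chainRelations x).mkQ (KaehlerDifferential.D ℂ (𝒳.O x) g)

/-- The stalk at `x` of the sheaf `𝒪_X(𝐓X)` of holomorphic vector fields: the derivations of the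
local ring `𝒪_{X,x}`. -/
abbrev VectorField (x : X) : Type u := Derivation ℂ (𝒳.O x) (𝒳.O x)

/-- Holomorphic vector fields on the open set `V`, i.e. derivations of the sheaf `𝒪_X` over `V`:
families of derivations of the local rings that map holomorphic functions on open subsets of `V` to
holomorphic functions. -/
def IsHolomorphicVectorField (V : Opens X) (v : ∀ y : V, 𝒳.VectorField y) : Prop :=
  ∀ (W : Opens X) (hWV : W ≤ V) (f : X → ℂ) (hf : ∀ y ∈ W, 𝒳.HolomorphicAt f y),
    ∃ g : X → ℂ, ∀ y (hy : y ∈ W),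
      (v ⟨y, hWV hy⟩ (holGerm f (hf y hy)) : (𝓝 y).Germ ℂ) = (g : (𝓝 y).Germ ℂ)

end

end AnalyticVariety

/-! ### Sheaves of families of germs -/

/-- A rule that gives, on each open set, a set of families of elements of groups `T x` (`x ∈ X`),
stable under restriction. -/
structure FamilyGenerators (X : TopCat.{u}) (T : X → Type u) where
  gen : ∀ V : Opens X, Set (∀ y : V, T y)
  res : ∀ {V V' : Opens X} (h : V' ≤ V), ∀ s ∈ gen V, (fun y : V' => s ⟨y, h y.2⟩) ∈ gen V'

namespace FamilyGenerators

variable {X : TopCat.{u}} {T : X → Type u} [∀ x, AddCommGroup (T x)] (P : FamilyGenerators X T)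

/-- Being a finite sum of generators (and of their opposites). -/
def prelocal : TopCat.PrelocalPredicate T where
  pred {U} s := s ∈ AddSubgroup.closure (P.gen U)
  res {V U} i s hs := by
    let r : (∀ y : U, T y) →+ (∀ y : V, T y) :=
      { toFun := fun s y => s ⟨y, i.le y.2⟩
        map_zero' := rfl
        map_add' := fun _ _ => rfl }
    have h : AddSubgroup.closure (P.gen U) ≤ (AddSubgroup.closure (P.gen V)).comap r :=
      (AddSubgroup.closure_le _).2 fun t ht => AddSubgroup.subset_closure (P.res i.le t ht)
    exact h hs

/-- The group of families over `U` that are locally finite sums of generators. -/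
def sections (U : Opens X) : AddSubgroup (∀ y : U, T y) where
  carrier := {s | P.prelocal.sheafify.pred s}
  zero_mem' := fun x => ⟨U, x.2, CategoryTheory.CategoryStruct.id U, AddSubgroup.zero_mem _⟩
  add_mem' {a b} ha hb x := by
    obtain ⟨V, hV, i, h⟩ := ha x
    obtain ⟨V', hV', i', h'⟩ := hb x
    exact ⟨V ⊓ V', ⟨hV, hV'⟩, CategoryTheory.homOfLE (le_trans inf_le_left i.le),
      AddSubgroup.add_mem _ (P.prelocal.res (CategoryTheory.homOfLE inf_le_left) _ h)
        (P.prelocal.res (CategoryTheory.homOfLE inf_le_right) _ h')⟩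
  neg_mem' {a} ha x := by
    obtain ⟨V, hV, i, h⟩ := ha x
    exact ⟨V, hV, i, AddSubgroup.neg_mem _ h⟩

/-- The presheaf `U ↦ P.sections U`. -/
def presheaf : TopCat.Presheaf AddCommGrpCat.{u} X where
  obj U := AddCommGrpCat.of (P.sections U.unop)
  map i := AddCommGrpCat.ofHom
    { toFun := fun s => ⟨fun y => s.1 (i.unop y), P.prelocal.sheafify.res i.unop s.1 s.2⟩
      map_zero' := rfl
      map_add' := fun _ _ => rfl }

/-- The sheaf of abelian groups whose sections are the families that are locally finite sums of
generators. -/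
def sheaf : TopCat.Sheaf AddCommGrpCat.{u} X where
  obj := P.presheaf
  property := (TopCat.Presheaf.isSheaf_iff_isSheaf_comp
    (CategoryTheory.forget AddCommGrpCat.{u}) P.presheaf).2
    (TopCat.Presheaf.isSheaf_of_iso
      (CategoryTheory.NatIso.ofComponents (fun _ => CategoryTheory.Iso.refl _) (fun _ => rfl))
      (TopCat.subpresheafToTypes.isSheaf P.prelocal.sheafify))

end FamilyGenerators

/-! ### Soft sheaves and fine sheaves -/

namespace TopCat.Sheaf

variable {X : TopCat.{u}} (F : TopCat.Sheaf AddCommGrpCat.{u} X)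

/-- A sheaf is soft if every section over a closed set `K` extends to a global section. A section
over `K` is a family of germs at the points of `K` which, near each point of `K`, consists of the
germs of a section over an open set. -/
def IsSoft : Prop :=
  ∀ (K : Set X) (_ : IsClosed K) (s : ∀ x : K, F.presheaf.stalk (x : X)),
    (∀ x : K, ∃ (U : Opens X) (_ : (x : X) ∈ U) (t : F.presheaf.obj (op U)),
      ∀ (y : K) (hy : (y : X) ∈ U), F.presheaf.germ U y hy t = s y) →
    ∃ t : F.presheaf.obj (op ⊤), ∀ y : K, F.presheaf.germ ⊤ y True.intro t = s y

/-- The additive map induced on the stalk at `x` by an endomorphism of a sheaf. -/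
noncomputable def stalkEnd (η : F ⟶ F) (x : X) : F.presheaf.stalk x →+ F.presheaf.stalk x :=
  ((TopCat.Presheaf.stalkFunctor AddCommGrpCat.{u} x).map η.hom).hom

/-- A sheaf is fine if for every locally finite open covering `U` there are endomorphisms `η i` of
the sheaf with support in `U i` (i.e. zero on the stalks over a neighbourhood of the complement of
`U i`) and with sum `1`. -/
def IsFine : Prop :=
  ∀ (ι : Type u) (U : ι → Opens X), LocallyFinite (fun i => (U i : Set X)) →
    (∀ x : X, ∃ i, x ∈ U i) →
    ∃ η : ι → (F ⟶ F), (∀ i, closure {x | F.stalkEnd (η i) x ≠ 0} ⊆ U i) ∧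
      ∀ (x : X) (a : F.presheaf.stalk x), ∑ᶠ i, F.stalkEnd (η i) x a = a

end TopCat.Sheaf

/-! ### The sheaves of extendable tensors and forms -/

namespace AnalyticVariety

noncomputable section

variable {n : ℕ} {X : Type u} [TopologicalSpace X] (𝒳 : AnalyticVariety n X)

/-- The stalk of `𝒮_p = Ω_X^p ⊗ 𝒞_X^∞` (tensor product over `𝒪_X`), with `Ω_X^p = Λ^p Ω_X`. The
factor `𝒞_X^∞` is written on the left. -/
abbrev FormStalk (p : ℕ) (x : X) : Type u := 𝒳.C x ⊗[𝒳.O x] ⋀[𝒳.O x]^p (𝒳.Omega x)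

/-- The generators `c ⊗ (dg₁ ∧ … ∧ dg_p)` of `𝒮_p` on an open set, with `c` smooth and the `gⱼ`
holomorphic there. -/
def formGenerators (p : ℕ) : FamilyGenerators (TopCat.of X) (𝒳.FormStalk p) where
  gen V := {s | ∃ (c : X → ℂ) (hc : ∀ y ∈ V, 𝒳.SmoothAt c y) (g : Fin p → X → ℂ)
    (hg : ∀ j, ∀ y ∈ V, 𝒳.HolomorphicAt (g j) y), ∀ y : V, s y =
      smoothGerm c (hc y y.2) ⊗ₜ[𝒳.O (y : X)]
        exteriorPower.ιMulti (𝒳.O (y : X)) p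
          (fun j => 𝒳.dGerm (holGerm (g j) (hg j y y.2)))}
  res := by
    rintro V V' h s ⟨c, hc, g, hg, hs⟩
    exact ⟨c, fun y hy => hc y (h hy), g, fun j y hy => hg j y (h hy), fun y => hs ⟨y, h y.2⟩⟩

/-- The sheaf `𝒮_p = Ω_X^p ⊗ 𝒞_X^∞`: the sheaf generated by the presheaf tensor product, realised
by families of elements of the stalks that are locally finite sums of elements
`c ⊗ (dg₁ ∧ … ∧ dg_p)`. -/
def formSheaf (p : ℕ) : TopCat.Sheaf AddCommGrpCat.{u} (TopCat.of X) := (𝒳.formGenerators p).sheaf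

/-- The stalk of `𝒮_{N,N*} = (Ω_X^{⊗N} ⊗ 𝒪_X(𝐓X)^{⊗N*}) ⊗ 𝒞_X^∞` (tensor products over `𝒪_X`). The
factor `𝒞_X^∞` is written on the left. -/
abbrev TensorStalk (N N' : ℕ) (x : X) : Type u :=
  𝒳.C x ⊗[𝒳.O x] ((⨂[𝒳.O x]^N (𝒳.Omega x)) ⊗[𝒳.O x] (⨂[𝒳.O x]^N' (𝒳.VectorField x)))

/-- The generators `c ⊗ ((dg₁ ⊗ … ⊗ dg_N) ⊗ (v₁ ⊗ … ⊗ v_{N*}))` of `𝒮_{N,N*}` on an open set, with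
`c` smooth, the functions `gⱼ` and the vector fields `vⱼ` holomorphic there. -/
def tensorGenerators (N N' : ℕ) : FamilyGenerators (TopCat.of X) (𝒳.TensorStalk N N') where
  gen V := {s | ∃ (c : X → ℂ) (hc : ∀ y ∈ V, 𝒳.SmoothAt c y) (g : Fin N → X → ℂ)
    (hg : ∀ j, ∀ y ∈ V, 𝒳.HolomorphicAt (g j) y)
    (v : Fin N' → ∀ y : V, 𝒳.VectorField (y : X)) (_ : ∀ j, 𝒳.IsHolomorphicVectorField V (v j)),
    ∀ y : V, s y =
      smoothGerm c (hc y y.2) ⊗ₜ[𝒳.O (y : X)]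
        ((PiTensorProduct.tprod (𝒳.O (y : X))
            fun j => 𝒳.dGerm (holGerm (g j) (hg j y y.2))) ⊗ₜ[𝒳.O (y : X)]
          (PiTensorProduct.tprod (𝒳.O (y : X)) fun j => v j y))}
  res := by
    rintro V V' h s ⟨c, hc, g, hg, v, hv, hs⟩
    exact ⟨c, fun y hy => hc y (h hy), g, fun j y hy => hg j y (h hy),
      fun j y => v j ⟨y, h y.2⟩,
      fun j W hW f hf => hv j W (hW.trans h) f hf, fun y => hs ⟨y, h y.2⟩⟩

/-- The sheaf `𝒮_{N,N*} = (Ω_X^{⊗N} ⊗ 𝒪_X(𝐓X)^{⊗N*}) ⊗ 𝒞_X^∞`, realised as for `𝒮_p`. -/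
def tensorSheaf (N N' : ℕ) : TopCat.Sheaf AddCommGrpCat.{u} (TopCat.of X) :=
  (𝒳.tensorGenerators N N').sheaf

/-- A section of `𝒮_p` over the regular part is an extendable `p`-form if it is the restriction of
a global section of `𝒮_p`. -/
def IsExtendableForm {p : ℕ} (s : (𝒳.formGenerators p).sections 𝒳.regularPart) : Prop :=
  ∃ t : (𝒳.formGenerators p).sections ⊤, ∀ y : 𝒳.regularPart, s.1 y = t.1 ⟨y, trivial⟩

/-- The function `f` on the regular part `X'` is an extendable `0`-form, functions being regarded
as sections of `𝒮_0` over `X'` through `f ↦ f ⊗ 1`. -/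
def IsExtendableZeroForm (f : X → ℂ) : Prop :=
  ∃ s : (𝒳.formGenerators 0).sections 𝒳.regularPart, 𝒳.IsExtendableForm s ∧
    ∀ y : 𝒳.regularPart, ∃ h : 𝒳.SmoothAt f y,
      s.1 y = smoothGerm f h ⊗ₜ[𝒳.O (y : X)] exteriorPower.ιMulti (𝒳.O (y : X)) 0 Fin.elim0

end

end AnalyticVariety

/-! ### Topology of analytic varieties -/

/-! Everything rests on smooth partitions of unity subordinate to an arbitrary open cover
(`exists_smooth_partitionOfUnity`). A subvariety is locally closed in `ℂᵐ`, so `X` is locally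
compact; with Hausdorffness and second countability, covers have suitable locally finite
refinements. Euclidean bumps pulled back through a chart and extended by zero are smooth on `X`,
because smoothness may be tested in a single chart (`AnalyticChart.SmoothAt.of_transition`).

For (a), a function smooth in a chart has local smooth extensions to the ambient space. Prescribing
values on `W` is a pointwise convex condition, so these extensions glue over all of `U`
(`exists_contDiffOn_extension`). A smooth function on `X` is itself a generator of `𝒮₀`, hence
extendable.

For (b), only one property of the tensor sheaves matters: their generators are stable under
multiplication by global smooth functions (`SmoothStable`). Multiplication by the `ρ i` gives the
endomorphisms required for fineness. For softness, local sections representing the data on `K` are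
multiplied by the `ρ i`, extended by zero and summed. -/

theorem IsHolomorphicSubvariety.eventually_notMem {m : ℕ} {U : Opens (Fin m → ℂ)}
    {W : Set (Fin m → ℂ)} (h : IsHolomorphicSubvariety U W) {z : Fin m → ℂ} (hz : z ∈ U)
    (hzW : z ∉ W) : ∀ᶠ w in 𝓝 z, w ∉ W := by
  obtain ⟨V, hzV, k, f, hf, hW⟩ := h.2 z hz
  have : ∃ j, f j z ≠ 0 := by
    by_contra! h0
    exact hzW (hW.symm.subset ⟨hzV, h0⟩ : z ∈ W ∩ V).1
  obtain ⟨j, hj⟩ := this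
  filter_upwards [V.isOpen.mem_nhds hzV, (hf j z hzV).continuousAt.eventually_ne hj] with w hwV hw hwW
  exact hw ((hW.subset ⟨hwW, hwV⟩).2 j)

theorem IsHolomorphicSubvariety.isLocallyClosed {m : ℕ} {U : Opens (Fin m → ℂ)}
    {W : Set (Fin m → ℂ)} (h : IsHolomorphicSubvariety U W) : IsLocallyClosed W := by
  have hO : IsOpen ((U : Set (Fin m → ℂ)) \ W) := isOpen_iff_mem_nhds.2 fun z hz => by
    filter_upwards [U.isOpen.mem_nhds hz.1, h.eventually_notMem hz.1 hz.2] with w h1 h2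
    exact ⟨h1, h2⟩
  refine ⟨U, _, U.isOpen, hO.isClosed_compl, ?_⟩
  ext z
  have := @h.1 z
  simp only [Set.mem_inter_iff, Set.mem_compl_iff, Set.mem_sdiff]
  tauto

/-- Locally closed subsets of `ℂᵐ` are locally compact, and compact neighbourhoods in an open chart
domain remain so in `X`. Hausdorffness upgrades weak local compactness. -/
theorem AnalyticVariety.locallyCompactSpace {n : ℕ} {X : Type u} [TopologicalSpace X] [T2Space X]
    (𝒳 : AnalyticVariety n X) : LocallyCompactSpace X := by
  have : WeaklyLocallyCompactSpace X := ⟨fun x => by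
    obtain ⟨c, -, hx⟩ := 𝒳.cover x
    have := c.isSubvariety.isLocallyClosed.locallyCompactSpace
    have := c.F.isClosedEmbedding.locallyCompactSpace
    obtain ⟨K, hK, hKx⟩ := exists_compact_mem_nhds (⟨x, hx⟩ : c.A)
    exact ⟨_, hK.image continuous_subtype_val,
      c.A.isOpen.isOpenEmbedding_subtypeVal.isOpenMap.image_mem_nhds hKx⟩⟩
  infer_instance

/-! ### Smooth functions in charts -/

namespace AnalyticChart

variable {X : Type u} [TopologicalSpace X]

/-- `f` extends, in the chart `c`, to a smooth function on a neighbourhood of `c.F x`. -/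
def SmoothAt (c : AnalyticChart X) (f : X → ℂ) (x : X) : Prop :=
  ∀ hx : x ∈ c.A, ∃ (V : Opens (Fin c.m → ℂ)) (G : (Fin c.m → ℂ) → ℂ),
    (c.F ⟨x, hx⟩ : Fin c.m → ℂ) ∈ V ∧ ContDiffOn ℝ ∞ G V ∧
      ∀ᶠ y in 𝓝 x, ∀ hy : y ∈ c.A, f y = G (c.F ⟨y, hy⟩)

/-- The coordinate change extends to an ambient holomorphic map `H`, which is smooth over `ℝ`; an
ambient extension `G` of `f` in `d` therefore pulls back to the extension `G ∘ H` in `c`. -/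
theorem SmoothAt.of_transition {c d : AnalyticChart X} {f : X → ℂ} {x : X} (h : d.SmoothAt f x)
    (hd : x ∈ d.A) (hdc : d.HolomorphicTransition c) : c.SmoothAt f x := by
  intro hc
  obtain ⟨V, G, hV, hG, hf⟩ := h hd
  obtain ⟨H, hH, hHF⟩ := hdc x hd hc
  have hHx := hHF.self_of_nhds hd hc
  have hev : ∀ᶠ z in 𝓝 (c.F ⟨x, hc⟩ : Fin c.m → ℂ), AnalyticAt ℂ H z ∧ H z ∈ V :=
    hH.eventually_analyticAt.and
      (hH.continuousAt.eventually (V.isOpen.mem_nhds (by rwa [hHx])))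
  obtain ⟨V', hV', hVo, hxV⟩ := eventually_nhds_iff.1 hev
  refine ⟨⟨V', hVo⟩, G ∘ H, hxV, hG.comp (fun z hz =>
    ((hV' z hz).1.contDiffAt.restrict_scalars ℝ).contDiffWithinAt) fun z hz => (hV' z hz).2, ?_⟩
  filter_upwards [hf, hHF, d.A.isOpen.mem_nhds hd] with y h1 h2 hyd hyc
  rw [h1 hyd, Function.comp_apply, h2 hyd hyc]

theorem SmoothAt.continuousAt {c : AnalyticChart X} {f : X → ℂ} {x : X} (h : c.SmoothAt f x)
    (hx : x ∈ c.A) : ContinuousAt f x := by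
  obtain ⟨V, G, hV, hG, hf⟩ := h hx
  have h1 : ContinuousAt (fun y : c.A => G (c.F y)) ⟨x, hx⟩ :=
    ContinuousAt.comp (f := fun y : c.A => (c.F y : Fin c.m → ℂ)) (g := G)
      (hG.continuousOn.continuousAt (V.isOpen.mem_nhds hV))
      (continuous_subtype_val.comp c.F.continuous).continuousAt
  rw [← c.A.isOpen.isOpenEmbedding_subtypeVal.continuousAt_iff (x := ⟨x, hx⟩)]
  refine h1.congr ?_
  filter_upwards [continuous_subtype_val.continuousAt.eventually hf] with y hy
  exact (hy y.2).symm

end AnalyticChart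

namespace AnalyticVariety

variable {n : ℕ} {X : Type u} [TopologicalSpace X] {𝒳 : AnalyticVariety n X}

theorem smoothAt_of_chart {c : AnalyticChart X} (hc : c ∈ 𝒳.maximalAtlas) {f : X → ℂ} {x : X}
    (hx : x ∈ c.A) (h : c.SmoothAt f x) : 𝒳.SmoothAt f x :=
  fun d hd => h.of_transition hx (hc d hd).1

theorem SmoothAt.chart {c : AnalyticChart X} (hc : c ∈ 𝒳.maximalAtlas) {f : X → ℂ} {x : X}
    (h : 𝒳.SmoothAt f x) : c.SmoothAt f x := by
  obtain ⟨d, hd, hx⟩ := 𝒳.cover x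
  exact AnalyticChart.SmoothAt.of_transition (h d hd) hx (hc d hd).2

/-! ### Algebraic operations and locally finite sums of smooth functions -/

namespace SmoothAt

variable {f g : X → ℂ} {x : X}

theorem continuousAt (h : 𝒳.SmoothAt f x) : ContinuousAt f x := by
  obtain ⟨d, hd, hx⟩ := 𝒳.cover x
  exact AnalyticChart.SmoothAt.continuousAt (h d hd) hx

theorem congr (h : 𝒳.SmoothAt f x) (hfg : g =ᶠ[𝓝 x] f) : 𝒳.SmoothAt g x := by
  intro c hc hx
  obtain ⟨V, G, hV, hG, hf⟩ := h c hc hx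
  refine ⟨V, G, hV, hG, ?_⟩
  filter_upwards [hf, hfg] with y h1 h2 hy
  rw [h2, h1 hy]

theorem const (a : ℂ) : 𝒳.SmoothAt (fun _ => a) x :=
  fun _ _ _ => ⟨⊤, fun _ => a, trivial, contDiffOn_const, by simp⟩

theorem add (hf : 𝒳.SmoothAt f x) (hg : 𝒳.SmoothAt g x) : 𝒳.SmoothAt (fun y => f y + g y) x := by
  intro c hc hx
  obtain ⟨V, G, hV, hG, hfG⟩ := hf c hc hx
  obtain ⟨V', H, hV', hH, hgH⟩ := hg c hc hx
  refine ⟨V ⊓ V', G + H, ⟨hV, hV'⟩, (hG.mono fun _ h => h.1).add (hH.mono fun _ h => h.2), ?_⟩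
  filter_upwards [hfG, hgH] with y h1 h2 hy
  simp [h1 hy, h2 hy]

theorem mul (hf : 𝒳.SmoothAt f x) (hg : 𝒳.SmoothAt g x) : 𝒳.SmoothAt (fun y => f y * g y) x := by
  intro c hc hx
  obtain ⟨V, G, hV, hG, hfG⟩ := hf c hc hx
  obtain ⟨V', H, hV', hH, hgH⟩ := hg c hc hx
  refine ⟨V ⊓ V', G * H, ⟨hV, hV'⟩, (hG.mono fun _ h => h.1).mul (hH.mono fun _ h => h.2), ?_⟩
  filter_upwards [hfG, hgH] with y h1 h2 hy
  simp [h1 hy, h2 hy]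

theorem inv (hf : 𝒳.SmoothAt f x) (h0 : f x ≠ 0) : 𝒳.SmoothAt (fun y => (f y)⁻¹) x := by
  intro c hc hx
  obtain ⟨V, G, hV, hG, hfG⟩ := hf c hc hx
  have hev : ∀ᶠ z in 𝓝 (c.F ⟨x, hx⟩ : Fin c.m → ℂ), z ∈ V ∧ G z ≠ 0 :=
    Filter.Eventually.and (V.isOpen.mem_nhds hV)
      ((hG.continuousOn.continuousAt (V.isOpen.mem_nhds hV)).eventually_ne
        (by rwa [← hfG.self_of_nhds hx]))
  obtain ⟨V', hV', hVo, hxV⟩ := eventually_nhds_iff.1 hev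
  refine ⟨⟨V', hVo⟩, fun z => (G z)⁻¹, hxV,
    (hG.mono fun z hz => (hV' z hz).1).inv fun z hz => (hV' z hz).2, ?_⟩
  filter_upwards [hfG] with y h1 hy
  rw [h1 hy]

theorem sum {α : Type*} (s : Finset α) {F : α → X → ℂ} (h : ∀ a ∈ s, 𝒳.SmoothAt (F a) x) :
    𝒳.SmoothAt (fun y => ∑ a ∈ s, F a y) x := by
  classical
  induction s using Finset.induction_on with
  | empty => simpa using const 0
  | insert a s ha ih =>
    simp only [Finset.sum_insert ha]
    exact (h a (by simp)).add (ih fun b hb => h b (by simp [hb]))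

theorem finsum {α : Type*} {F : α → X → ℂ} (hF : LocallyFinite fun a => Function.support (F a))
    (h : ∀ a, 𝒳.SmoothAt (F a) x) : 𝒳.SmoothAt (fun y => ∑ᶠ a, F a y) x := by
  obtain ⟨s, hs⟩ := hF.exists_finset_support x
  refine (sum s fun a _ => h a).congr ?_
  filter_upwards [hs] with y hy
  exact finsum_eq_sum_of_support_subset _ hy

end SmoothAt

/-! ### Smooth partitions of unity -/

/-- Smooth bump functions exist in every neighbourhood of a point. -/
theorem exists_smooth_bump [T2Space X] (𝒳 : AnalyticVariety n X) (x : X) {N : Set X}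
    (hN : N ∈ 𝓝 x) : ∃ g : X → ℝ, (∀ y, 𝒳.SmoothAt (fun y => (g y : ℂ)) y) ∧ (∀ y, 0 ≤ g y) ∧
      0 < g x ∧ tsupport g ⊆ N := by
  classical
  obtain ⟨c, hc, hx⟩ := 𝒳.cover x
  have := 𝒳.locallyCompactSpace
  -- A compact `K` inside the chart domain is closed in `X`, so a function supported in `K` and
  -- extended by zero has no trouble at the boundary of the domain.
  obtain ⟨K, hK, hKN, hKc⟩ := local_compact_nhds
    (Filter.inter_mem hN (c.A.isOpen.mem_nhds hx))
  have hKA : ((↑) : c.A → X) ⁻¹' K ∈ 𝓝 (⟨x, hx⟩ : c.A) :=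
    continuous_subtype_val.continuousAt.preimage_mem_nhds hK
  -- `K` contains the trace on `W` of an ambient neighbourhood `t`, which is where the Euclidean
  -- bump is supported.
  rw [(Topology.IsInducing.subtypeVal.comp c.F.isInducing).nhds_eq_comap] at hKA
  obtain ⟨t, ht, htK⟩ := Filter.mem_comap.1 hKA
  obtain ⟨φ, hsupp, -, hsm, hnn, hφx⟩ := exists_contDiff_tsupport_subset (n := ⊤) ht
  let g : X → ℝ := fun y => if hy : y ∈ c.A then φ (c.F ⟨y, hy⟩) else 0
  have hgK : tsupport g ⊆ K := by
    refine closure_minimal (fun y hy => ?_) hKc.isClosed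
    have hyA : y ∈ c.A := by
      by_contra h
      exact hy (dif_neg h)
    refine htK (a := ⟨y, hyA⟩) (hsupp (subset_tsupport _ ?_))
    have : g y ≠ 0 := hy
    simpa [g, hyA] using this
  refine ⟨g, fun y => ?_, fun y => ?_, ?_, fun y hy => (hKN (hgK hy)).1⟩
  · by_cases hy : y ∈ tsupport g
    · refine smoothAt_of_chart (fun d hd => 𝒳.compatible c hc d hd) (hKN (hgK hy)).2 fun hyA =>
        ⟨⊤, fun z => (φ z : ℂ), trivial,
          (Complex.ofRealCLM.contDiff.comp hsm).contDiffOn, .of_forall fun z hz => ?_⟩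
      simp [g, hz]
    · refine (SmoothAt.const 0).congr ?_
      filter_upwards [(isClosed_tsupport g).isOpen_compl.mem_nhds hy] with z hz
      simp [image_eq_zero_of_notMem_tsupport hz]
  · by_cases hy : y ∈ c.A
    · simpa [g, hy] using (hnn ⟨_, rfl⟩).1
    · simp [g, hy]
  · simp_all [g]

/-- A locally finite family of bumps `r a`, each with closed support in some member of the cover, is
grouped by that member and divided by its total `S`, which is smooth and positive. -/
theorem exists_smooth_partitionOfUnity [T2Space X] [SecondCountableTopology X]
    (𝒳 : AnalyticVariety n X) {ι : Type*} (U : ι → Opens X) (hU : ∀ x, ∃ i, x ∈ U i) :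
    ∃ ρ : PartitionOfUnity ι X, ρ.IsSubordinate (fun i => (U i : Set X)) ∧
      ∀ i x, 𝒳.SmoothAt (fun y => (ρ i y : ℂ)) x := by
  classical
  have := 𝒳.locallyCompactSpace
  -- Indexing the neighbourhood basis by functions makes the refinement consist of supports with
  -- their bumps still attached.
  have hB : ∀ x : X, (𝓝 x).HasBasis
      (fun g : X → ℝ => (∀ y, 𝒳.SmoothAt (fun y => (g y : ℂ)) y) ∧ (∀ y, 0 ≤ g y) ∧
        0 < g x ∧ ∃ i, tsupport g ⊆ U i) (fun g => Function.support g) := by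
    refine fun x => ⟨fun N => ⟨fun hN => ?_, ?_⟩⟩
    · obtain ⟨i, hi⟩ := hU x
      obtain ⟨g, h1, h2, h3, h4⟩ := 𝒳.exists_smooth_bump x
        (Filter.inter_mem hN ((U i).isOpen.mem_nhds hi))
      exact ⟨g, ⟨h1, h2, h3, i, fun y hy => (h4 hy).2⟩,
        fun y hy => (h4 (subset_tsupport _ hy)).1⟩
    · rintro ⟨g, ⟨h1, -, h3, -⟩, hgN⟩
      refine Filter.mem_of_superset ?_ hgN
      have := (h1 x).continuousAt.eventually_ne (Complex.ofReal_ne_zero.2 h3.ne')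
      filter_upwards [this] with y hy
      simpa using hy
  obtain ⟨α, c, r, hp, hcov, hfin⟩ := refinement_of_locallyCompact_sigmaCompact_of_nhds_basis hB
  have hsm := fun a => (hp a).1
  have hnn := fun a => (hp a).2.1
  -- Each bump is assigned to one index `b a`, so that `σ i` below collects the bumps assigned to
  -- `i` and none is counted twice.
  choose b hb using fun a => (hp a).2.2.2
  have hfinx : ∀ x, (Function.support fun a => r a x).Finite := fun x => hfin.point_finite x
  let S : X → ℝ := fun x => ∑ᶠ a, r a x
  have hS : ∀ x, 0 < S x := fun x => by
    obtain ⟨a, ha⟩ := Set.mem_iUnion.1 (hcov.symm.subset (Set.mem_univ x))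
    exact finsum_pos (fun a => hnn a x) ⟨a, lt_of_le_of_ne (hnn a x) (Ne.symm ha)⟩ (hfinx x)
  have hcast : ∀ (F : α → ℝ), (Function.support F).Finite →
      ((∑ᶠ a, F a : ℝ) : ℂ) = ∑ᶠ a, (F a : ℂ) := fun F hF =>
    Complex.ofRealHom.toAddMonoidHom.map_finsum hF
  have hSs : ∀ x, 𝒳.SmoothAt (fun y => (S y : ℂ)) x := fun x => by
    simp only [S, hcast _ (hfinx _)]
    refine SmoothAt.finsum ?_ fun a => hsm a x
    simpa [Function.support] using hfin
  let q : ι → α → X → ℝ := fun i a x => if b a = i then r a x else 0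
  have hqs : ∀ i a, Function.support (q i a) ⊆ Function.support (r a) := fun i a x hx h0 => by
    simp_all [q]
  have hqfin : ∀ i, LocallyFinite fun a => Function.support (q i a) := fun i =>
    hfin.subset (hqs i)
  have hqfinx : ∀ i x, (Function.support fun a => q i a x).Finite := fun i x =>
    (hqfin i).point_finite x
  let σ : ι → X → ℝ := fun i x => ∑ᶠ a, q i a x
  have hσs : ∀ i x, 𝒳.SmoothAt (fun y => (σ i y : ℂ)) x := fun i x => by
    simp only [σ, hcast _ (hqfinx i _)]
    refine SmoothAt.finsum (by simpa [Function.support] using hqfin i) fun a => ?_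
    by_cases h : b a = i
    · simpa [q, h] using hsm a x
    · simpa [q, h] using SmoothAt.const 0
  let ρ : ι → X → ℝ := fun i x => σ i x * (S x)⁻¹
  have hρs : ∀ i x, 𝒳.SmoothAt (fun y => (ρ i y : ℂ)) x := fun i x => by
    simpa [ρ] using (hσs i x).mul ((hSs x).inv (by exact_mod_cast (hS x).ne'))
  have hρc : ∀ i, Continuous (ρ i) := fun i => continuous_iff_continuousAt.2 fun x => by
    simpa [Function.comp_def] using Complex.continuous_re.continuousAt.comp (hρs i x).continuousAt
  have hρsupp : ∀ i x, ρ i x ≠ 0 → ∃ a, b a = i ∧ x ∈ Function.support (r a) := fun i x hx => by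
    obtain ⟨a, ha⟩ : ∃ a, q i a x ≠ 0 := by
      by_contra! h
      exact left_ne_zero_of_mul hx (by simp [σ, h])
    refine ⟨a, ?_, hqs i a ha⟩
    by_contra h
    simp [q, h] at ha
  have hsum : ∀ x, ∑ᶠ i, ρ i x = 1 := fun x => by
    have h1 : ∑ᶠ i, σ i x = S x := by
      let s := (hfinx x).toFinset
      have h2 : ∀ i, σ i x = ∑ a ∈ s, q i a x := fun i =>
        finsum_eq_sum_of_support_subset _ fun a ha => by simpa [s] using hqs i a ha
      have h3 : (Function.support fun i => σ i x) ⊆ (s.image b : Finset ι) := fun i hi => by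
        obtain ⟨a, rfl, ha⟩ := hρsupp i x (mul_ne_zero hi (inv_ne_zero (hS x).ne'))
        simpa using ⟨a, by simpa [s] using ha, rfl⟩
      have h4 : S x = ∑ a ∈ s, r a x := finsum_eq_sum _ (hfinx x)
      rw [finsum_eq_sum_of_support_subset _ h3, h4]
      simp only [h2, q]
      rw [Finset.sum_comm]
      refine Finset.sum_congr rfl fun a ha => ?_
      rw [Finset.sum_ite_eq, if_pos (Finset.mem_image_of_mem b ha)]
    simp only [ρ]
    rw [← finsum_mul, h1, mul_inv_cancel₀ (hS x).ne']
  refine ⟨{ toFun := fun i => ⟨ρ i, hρc i⟩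
            locallyFinite' := fun x => ?_
            nonneg' := fun i x => ?_
            sum_eq_one' := fun x _ => hsum x
            sum_le_one' := fun x => (hsum x).le }, fun i => ?_, hρs⟩
  · obtain ⟨N, hN, hNf⟩ := hfin x
    refine ⟨N, hN, (hNf.image b).subset ?_⟩
    rintro i ⟨y, hy, hyN⟩
    obtain ⟨a, rfl, ha⟩ := hρsupp i y hy
    exact ⟨a, ⟨y, ha, hyN⟩, rfl⟩
  · refine mul_nonneg (finsum_nonneg fun a => ?_) (inv_nonneg.2 (hS x).le)
    simp only [q]
    split_ifs
    exacts [hnn a x, le_rfl]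
  -- Local finiteness makes this union closed, so it contains the closure of the support of `ρ i`,
  -- not just the support.
  · have hcl : IsClosed (⋃ a : {a // b a = i}, tsupport (r a)) :=
      (hfin.closure.comp_injective Subtype.val_injective).isClosed_iUnion
        fun a => isClosed_closure
    refine (closure_minimal (fun x hx => ?_) hcl).trans (Set.iUnion_subset fun a => ?_)
    · obtain ⟨a, ha, hax⟩ := hρsupp i x hx
      exact Set.mem_iUnion.2 ⟨⟨a, ha⟩, subset_tsupport _ hax⟩
    · exact (hb a.1).trans (congrArg (fun j => (U j : Set X)) a.2).subset

/-! ### Extension to the ambient space of a chart -/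

/-- Local extensions are averaged by a partition of unity on the manifold `U`; averages of functions
with the same values on `W` keep those values. -/
theorem exists_contDiffOn_extension {c : AnalyticChart X} {f : X → ℝ}
    (h : ∀ x, c.SmoothAt (fun y => (f y : ℂ)) x) :
    ∃ R : (Fin c.m → ℂ) → ℝ, ContDiffOn ℝ ∞ R c.U ∧ ∀ w : c.W, R w = f (c.F.symm w) := by
  classical
  let t : c.U → Set ℝ := fun z => {a | ∀ hz : (z : Fin c.m → ℂ) ∈ c.W, a = f (c.F.symm ⟨z, hz⟩)}
  have ht : ∀ z, Convex ℝ (t z) := fun z => by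
    by_cases hz : (z : Fin c.m → ℂ) ∈ c.W
    · have : t z = {f (c.F.symm ⟨z, hz⟩)} := by ext; simp [t, hz]
      rw [this]
      exact convex_singleton _
    · have : t z = Set.univ := by ext; simp [t, hz]
      rw [this]
      exact convex_univ
  have : SigmaCompactSpace c.U := by
    have : LocallyCompactSpace c.U := c.U.isOpen.locallyCompactSpace
    infer_instance
  obtain ⟨g, hg⟩ := exists_contMDiffMap_forall_mem_convex_of_local (n := ⊤)
    (modelWithCornersSelf ℝ (Fin c.m → ℂ)) ht fun z => by
    by_cases hz : (z : Fin c.m → ℂ) ∈ c.W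
    · obtain ⟨V, G, hV, hG, hf⟩ := h _ (c.F.symm ⟨z, hz⟩).2
      simp only [Subtype.coe_eta, Homeomorph.apply_symm_apply] at hV
      have h1 := continuous_subtype_val.continuousAt.eventually hf
      have h2 := (c.F.symm.continuous.continuousAt (x := ⟨z, hz⟩)).eventually h1
      rw [nhds_subtype_eq_comap] at h2
      obtain ⟨N, hN, hNG⟩ := Filter.mem_comap.1 h2
      -- The local extension `G` is complex valued; its real part still extends the real function
      -- `f`.
      refine ⟨((↑) : c.U → Fin c.m → ℂ) ⁻¹' (N ∩ V),
        continuous_subtype_val.continuousAt.preimage_mem_nhds (Filter.inter_mem hN (V.isOpen.mem_nhds hV)), fun y => (G y).re, ?_, ?_⟩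
      · have : ContDiffOn ℝ ∞ (fun y => (G y).re) V := Complex.reCLM.contDiff.comp_contDiffOn hG
        exact this.contMDiffOn.comp contMDiff_subtype_val.contMDiffOn fun y hy => hy.2
      · intro y hy hyW
        have := hNG (a := ⟨y, hyW⟩) hy.1
        simp only [Set.mem_ofPred_eq, Subtype.coe_eta, Homeomorph.apply_symm_apply] at this
        change (G y).re = _
        rw [← this (c.F.symm _).2, Complex.ofReal_re]
    -- `W` is closed in `U`, so there is no constraint near `z` and zero will do.
    · refine ⟨_, continuous_subtype_val.continuousAt.preimage_mem_nhds
        (c.isSubvariety.eventually_notMem z.2 hz), fun _ => 0, contMDiffOn_const, ?_⟩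
      exact fun y hy hyW => absurd hyW hy
  -- The value `0` off `U` is arbitrary: smoothness is claimed only on `U`.
  refine ⟨fun z => if hz : z ∈ c.U then g ⟨z, hz⟩ else 0, fun z hz => ?_, fun w => ?_⟩
  · refine ContDiffAt.contDiffWithinAt ?_
    rw [← contMDiffAt_iff_contDiffAt, ← contMDiffAt_subtype_iff (x := (⟨z, hz⟩ : c.U))]
    refine (g.contMDiff _).congr_of_eventuallyEq (.of_forall fun y => ?_)
    simp
  · have hw : (w : Fin c.m → ℂ) ∈ c.U := c.isSubvariety.1 w.2
    simpa [hw] using hg ⟨w, hw⟩ w.2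

end AnalyticVariety

/-! ### Sections and germs of sheaves of families -/

namespace FamilyGenerators

open CategoryTheory TopCat.Presheaf

variable {X : TopCat.{u}} {T : X → Type u} [∀ x, AddCommGroup (T x)] (P : FamilyGenerators X T)

theorem mem_sections_of_mem_gen {U : Opens X} {s : ∀ y : U, T y} (hs : s ∈ P.gen U) :
    s ∈ P.sections U :=
  fun x => ⟨U, x.2, 𝟙 U, AddSubgroup.subset_closure hs⟩

theorem res_mem_sections {U V : Opens X} (h : V ≤ U) {s : ∀ y : U, T y} (hs : s ∈ P.sections U) :
    (fun y : V => s ⟨y, h y.2⟩) ∈ P.sections V :=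
  P.prelocal.sheafify.res (homOfLE h) s hs

/-- Gluing in concrete form: it certifies extensions by zero and locally finite sums as sections. -/
theorem mem_sections_of_local {U : Opens X} {s : ∀ y : U, T y}
    (h : ∀ x ∈ U, ∃ (V : Opens X) (hVU : V ≤ U), x ∈ V ∧
      (fun y : V => s ⟨y, hVU y.2⟩) ∈ P.sections V) : s ∈ P.sections U := by
  intro x
  obtain ⟨V, hVU, hxV, hV⟩ := h x x.2
  obtain ⟨W, hW, i, hi⟩ := hV ⟨x, hxV⟩
  exact ⟨W, hW, i ≫ homOfLE hVU, hi⟩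

variable {P}

/-- The germ of a section of the sheaf of families. -/
noncomputable def germ {U : Opens X} (x : X) (hx : x ∈ U) :
    P.sections U →+ P.sheaf.presheaf.stalk x :=
  (P.sheaf.presheaf.germ U x hx).hom

theorem exists_germ_eq {x : X} (a : P.sheaf.presheaf.stalk x) :
    ∃ (U : Opens X) (hx : x ∈ U) (s : P.sections U), germ x hx s = a :=
  TopCat.Presheaf.exists_germ_eq P.sheaf.presheaf a

theorem germ_congr {U V : Opens X} {x : X} (hU : x ∈ U) (hV : x ∈ V) {s : P.sections U}
    {t : P.sections V} (h : ∀ᶠ y in 𝓝 x, ∀ (hyU : y ∈ U) (hyV : y ∈ V), s.1 ⟨y, hyU⟩ = t.1 ⟨y, hyV⟩) :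
    germ x hU s = germ x hV t := by
  obtain ⟨N, hN, hNo, hxN⟩ := eventually_nhds_iff.1 h
  refine TopCat.Presheaf.germ_ext P.sheaf.presheaf (U ⊓ V ⊓ ⟨N, hNo⟩) ⟨⟨hU, hV⟩, hxN⟩
    (homOfLE fun y hy => hy.1.1) (homOfLE fun y hy => hy.1.2) ?_
  exact Subtype.ext (funext fun y => hN y y.2.2 y.2.1.1 y.2.1.2)

/-- An endomorphism of the sheaf of families from additive maps of the groups of values that
preserve sections. -/
def endOfMap (m : ∀ x, T x →+ T x)
    (hm : ∀ (U : Opens X) (s : ∀ y : U, T y), s ∈ P.sections U →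
      (fun y : U => m y (s y)) ∈ P.sections U) : P.sheaf ⟶ P.sheaf where
  hom :=
    { app U := AddCommGrpCat.ofHom
        { toFun := fun s : P.sections U.unop => (⟨_, hm U.unop s.1 s.2⟩ : P.sections U.unop)
          map_zero' := Subtype.ext (funext fun y => (m y).map_zero)
          map_add' := fun _ _ => Subtype.ext (funext fun y => (m y).map_add _ _) }
      naturality := fun _ _ _ => rfl }

theorem stalkEnd_endOfMap_germ (m : ∀ x, T x →+ T x)
    (hm : ∀ (U : Opens X) (s : ∀ y : U, T y), s ∈ P.sections U →
      (fun y : U => m y (s y)) ∈ P.sections U) {U : Opens X} {x : X} (hx : x ∈ U)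
    (s : P.sections U) :
    P.sheaf.stalkEnd (endOfMap m hm) x (germ x hx s) =
      germ x hx ⟨fun y => m y (s.1 y), hm U s.1 s.2⟩ :=
  stalkFunctor_map_germ_apply (F := P.sheaf.presheaf) (G := P.sheaf.presheaf) U x hx
    (endOfMap m hm).hom s

end FamilyGenerators

/-! ### Sheaves of modules over the smooth functions are fine and soft -/

namespace AnalyticVariety

open FamilyGenerators

variable {n : ℕ} {X : Type u} [TopologicalSpace X] {𝒳 : AnalyticVariety n X}

theorem smoothGerm_eq_zero {f : X → ℂ} {x : X} (h : 𝒳.SmoothAt f x) (h0 : f =ᶠ[𝓝 x] 0) :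
    smoothGerm f h = 0 :=
  Subtype.ext (Filter.Germ.coe_eq.2 h0)

theorem sum_smoothGerm_eq_one {α : Type*} {I : Finset α} {f : α → X → ℂ} {x : X}
    (h : ∀ a, 𝒳.SmoothAt (f a) x) (h1 : ∀ᶠ y in 𝓝 x, ∑ a ∈ I, f a y = 1) :
    ∑ a ∈ I, smoothGerm (f a) (h a) = 1 := by
  refine Subtype.ext ?_
  rw [AddSubmonoidClass.coe_finsetSum]
  change ∑ a ∈ I, Filter.Germ.coeRingHom (𝓝 x) (f a) = _
  rw [← map_sum]
  exact Filter.Germ.coe_eq.2 (h1.mono fun y hy => by simpa using hy)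

section

variable {T : X → Type u} [∀ x, AddCommGroup (T x)] [∀ x, Module (𝒳.C x) (T x)]
  {P : FamilyGenerators (TopCat.of X) T}

/-- The generators are stable under multiplication by smooth functions. -/
def SmoothStable (𝒳 : AnalyticVariety n X) {T : X → Type u} [∀ x, AddCommGroup (T x)]
    [∀ x, Module (𝒳.C x) (T x)] (P : FamilyGenerators (TopCat.of X) T) : Prop :=
  ∀ (f : X → ℂ) (hf : ∀ x, 𝒳.SmoothAt f x) (V : Opens X), ∀ s ∈ P.gen V,
    (fun y : V => smoothGerm f (hf y) • s y) ∈ P.gen V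

/-- Multiplication by `f` is additive, so stability passes from generators to the subgroup they
generate, and then to families locally in it. -/
theorem SmoothStable.smul_mem_sections (hP : 𝒳.SmoothStable P) {f : X → ℂ}
    (hf : ∀ x, 𝒳.SmoothAt f x) (U : Opens X) (s : ∀ y : U, T y) (hs : s ∈ P.sections U) :
    (fun y : U => smoothGerm f (hf y) • s y) ∈ P.sections U := by
  intro x
  obtain ⟨V, hV, i, h⟩ := hs x
  refine ⟨V, hV, i, ?_⟩
  let r : (∀ y : V, T y) →+ (∀ y : V, T y) :=
    { toFun := fun s y => smoothGerm f (hf y) • s y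
      map_zero' := funext fun _ => smul_zero _
      map_add' := fun _ _ => funext fun _ => smul_add _ _ _ }
  have hr : AddSubgroup.closure (P.gen V) ≤ (AddSubgroup.closure (P.gen V)).comap r :=
    (AddSubgroup.closure_le _).2 fun t ht => AddSubgroup.subset_closure (hP f hf V t ht)
  exact hr h

/-- Multiplication by a smooth function as an endomorphism of the sheaf of families. -/
def smulEnd (hP : 𝒳.SmoothStable P) (f : X → ℂ) (hf : ∀ x, 𝒳.SmoothAt f x) : P.sheaf ⟶ P.sheaf :=
  endOfMap (fun x => DistribSMul.toAddMonoidHom (T x) (smoothGerm f (hf x)))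
    (hP.smul_mem_sections hf)

theorem stalkEnd_smulEnd_germ (hP : 𝒳.SmoothStable P) {f : X → ℂ} (hf : ∀ x, 𝒳.SmoothAt f x)
    {U : Opens X} {x : X} (hx : x ∈ U) (s : P.sections U) :
    P.sheaf.stalkEnd (smulEnd hP f hf) x (germ (X := TopCat.of X) x hx s) =
      germ (X := TopCat.of X) x hx
        ⟨fun y => smoothGerm f (hf y) • s.1 y, hP.smul_mem_sections hf U s.1 s.2⟩ :=
  stalkEnd_endOfMap_germ (X := TopCat.of X) _ _ hx s

theorem stalkEnd_smulEnd_eq_zero (hP : 𝒳.SmoothStable P) {f : X → ℂ} (hf : ∀ x, 𝒳.SmoothAt f x)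
    {x : X} (h : x ∉ tsupport f) : P.sheaf.stalkEnd (smulEnd hP f hf) x = 0 := by
  ext a
  obtain ⟨U, hx, s, rfl⟩ := exists_germ_eq (X := TopCat.of X) a
  rw [stalkEnd_smulEnd_germ, AddMonoidHom.zero_apply, ← map_zero (germ (P := P) x hx)]
  refine germ_congr (X := TopCat.of X) hx hx ?_
  filter_upwards [(isClosed_tsupport f).isOpen_compl.mem_nhds h] with y hy hyU _
  change smoothGerm f (hf y) • s.1 ⟨y, hyU⟩ = 0
  rw [smoothGerm_eq_zero (hf y) (notMem_tsupport_iff_eventuallyEq.1 hy), zero_smul]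

variable {ι : Type*} (ρ : PartitionOfUnity ι X)

theorem tsupport_ofReal (f : X → ℝ) : tsupport (fun y => (f y : ℂ)) = tsupport f := by
  simp [tsupport, Function.support]

/-- Closed supports are used because multiplication by `ρ i` is known to vanish on stalks only off
`tsupport`. -/
theorem exists_finset_tsupport (x : X) :
    ∃ I : Finset ι, ∀ᶠ y in 𝓝 x, ∀ i, y ∈ tsupport (fun y => (ρ i y : ℂ)) → i ∈ I := by
  obtain ⟨N, hN, hf⟩ := ρ.locallyFinite.closure x
  refine ⟨hf.toFinset, ?_⟩
  filter_upwards [hN] with y hy i hi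
  rw [tsupport_ofReal] at hi
  exact hf.mem_toFinset.2 ⟨y, hi, hy⟩

theorem sum_smoothGerm_partitionOfUnity (hρ : ∀ i x, 𝒳.SmoothAt (fun y => (ρ i y : ℂ)) x)
    {x : X} {I : Finset ι}
    (hI : ∀ᶠ y in 𝓝 x, ∀ i, y ∈ tsupport (fun y => (ρ i y : ℂ)) → i ∈ I) :
    ∑ i ∈ I, smoothGerm _ (hρ i x) = 1 := by
  refine sum_smoothGerm_eq_one (fun i => hρ i x) (hI.mono fun y hy => ?_)
  rw [← Complex.ofReal_sum, ← Complex.ofReal_one, ← ρ.sum_eq_one (Set.mem_univ y)]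
  refine congrArg _ (finsum_eq_sum_of_support_subset _ fun i hi => hy i (subset_tsupport _ ?_)).symm
  exact Complex.ofReal_ne_zero.2 hi

theorem sum_stalkEnd_smulEnd (hP : 𝒳.SmoothStable P)
    (hρ : ∀ i x, 𝒳.SmoothAt (fun y => (ρ i y : ℂ)) x) {x : X} (a : P.sheaf.presheaf.stalk x)
    {I : Finset ι} (hI : ∀ᶠ y in 𝓝 x, ∀ i, y ∈ tsupport (fun y => (ρ i y : ℂ)) → i ∈ I) :
    ∑ i ∈ I, P.sheaf.stalkEnd (smulEnd hP _ (hρ i)) x a = a := by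
  obtain ⟨U, hx, s, rfl⟩ := exists_germ_eq (X := TopCat.of X) a
  refine (Finset.sum_congr rfl fun i _ => stalkEnd_smulEnd_germ hP (hρ i) hx s).trans ?_
  rw [← map_sum]
  refine germ_congr (X := TopCat.of X) hx hx ?_
  -- The germs of the `ρ i` must sum to `1` at each nearby `y`, so the condition on `I` is needed in
  -- a neighbourhood of `y` as well.
  filter_upwards [hI.eventually_nhds] with y hy hyU _
  rw [AddSubmonoidClass.coe_finsetSum, Finset.sum_apply]
  change ∑ i ∈ I, smoothGerm _ (hρ i y) • s.1 ⟨y, hyU⟩ = _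
  rw [← Finset.sum_smul, sum_smoothGerm_partitionOfUnity ρ hρ hy, one_smul]

theorem finsum_stalkEnd_smulEnd (hP : 𝒳.SmoothStable P)
    (hρ : ∀ i x, 𝒳.SmoothAt (fun y => (ρ i y : ℂ)) x) (x : X) (a : P.sheaf.presheaf.stalk x) :
    ∑ᶠ i, P.sheaf.stalkEnd (smulEnd hP _ (hρ i)) x a = a := by
  obtain ⟨I, hI⟩ := exists_finset_tsupport ρ x
  refine (finsum_eq_sum_of_support_subset _ fun i hi => hI.self_of_nhds i ?_).trans
    (sum_stalkEnd_smulEnd ρ hP hρ a hI)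
  by_contra h
  exact hi (DFunLike.congr_fun (stalkEnd_smulEnd_eq_zero hP (hρ i) h) a)

variable [T2Space X] [SecondCountableTopology X]

theorem SmoothStable.isFine (hP : 𝒳.SmoothStable P) : P.sheaf.IsFine := by
  intro ι U _ hU
  obtain ⟨ρ, hρU, hρ⟩ := 𝒳.exists_smooth_partitionOfUnity U hU
  refine ⟨fun i => smulEnd hP _ (hρ i), fun i => ?_, finsum_stalkEnd_smulEnd ρ hP hρ⟩
  refine (closure_minimal (fun x hx => ?_) (isClosed_tsupport _)).trans (hρU i)
  rw [← tsupport_ofReal]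
  by_contra h
  exact hx (stalkEnd_smulEnd_eq_zero hP (hρ i) h)

-- Where `ρ i` is nonzero the `i`-th local section represents `s` on `K`, so the sum of the products
-- has germ `∑ ρ i • s = s` at every point of `K`.
open Classical in
theorem SmoothStable.isSoft (hP : 𝒳.SmoothStable P) : P.sheaf.IsSoft := by
  intro K hK s hs
  choose U hxU t ht using hs
  -- The index `none` stands for the complement of `K`, which completes the cover. It carries the
  -- zero section and contains no point where agreement with `s` is required.
  let V : Option K → Opens X := fun i => i.elim ⟨Kᶜ, hK.isOpen_compl⟩ U
  let τ : ∀ i, P.sections (V i) := fun i => match i with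
    | none => 0
    | some x => t x
  have hτ : ∀ i (y : K) (hy : (y : X) ∈ V i), germ (X := TopCat.of X) (y : X) hy (τ i) = s y :=
    fun i y hy => match i with
    | none => absurd y.2 hy
    | some x => ht x y hy
  obtain ⟨ρ, hρV, hρ⟩ := 𝒳.exists_smooth_partitionOfUnity V fun x => by
    by_cases hx : x ∈ K
    · exact ⟨some ⟨x, hx⟩, hxU ⟨x, hx⟩⟩
    · exact ⟨none, hx⟩
  have hsub : ∀ i, tsupport (fun y => (ρ i y : ℂ)) ⊆ V i := fun i => by
    rw [tsupport_ofReal]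
    exact hρV i
  -- Extension by zero is a section because `tsupport (ρ i)` lies in `V i`: the two open sets `V i`
  -- and the complement of `tsupport (ρ i)` cover `X`.
  let e : Option K → ∀ y : (⊤ : Opens X), T y := fun i y =>
    if hy : (y : X) ∈ V i then smoothGerm _ (hρ i y) • (τ i).1 ⟨y, hy⟩ else 0
  have hzero : ∀ i (y : (⊤ : Opens X)), (y : X) ∉ tsupport (fun y => (ρ i y : ℂ)) → e i y = 0 :=
    fun i y hy => by
      simp only [e, smoothGerm_eq_zero (hρ i y) (notMem_tsupport_iff_eventuallyEq.1 hy), zero_smul,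
        dite_eq_ite, ite_self]
  have he : ∀ i, e i ∈ P.sections ⊤ := fun i => by
    refine P.mem_sections_of_local fun x _ => ?_
    by_cases hx : x ∈ V i
    · refine ⟨V i, le_top, hx, ?_⟩
      convert hP.smul_mem_sections (hρ i) (V i) (τ i).1 (τ i).2 using 2 with y
      exact dif_pos y.2
    · refine ⟨⟨_, (isClosed_tsupport fun y => (ρ i y : ℂ)).isOpen_compl⟩, le_top,
        fun h => hx (hsub i h), ?_⟩
      have h0 : (fun y : (⟨_, (isClosed_tsupport fun y => (ρ i y : ℂ)).isOpen_compl⟩ : Opens X) =>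
          e i ⟨y, trivial⟩) = 0 := funext fun y => hzero i _ y.2
      exact h0 ▸ (P.sections _).zero_mem
  have hgerm : ∀ i (y : K), germ (X := TopCat.of X) (U := ⊤) (y : X) trivial ⟨e i, he i⟩ =
      P.sheaf.stalkEnd (smulEnd hP _ (hρ i)) (y : X) (s y) := fun i y => by
    by_cases hy : (y : X) ∈ tsupport (fun y => (ρ i y : ℂ))
    · rw [← hτ i y (hsub i hy), stalkEnd_smulEnd_germ]
      exact germ_congr (X := TopCat.of X) _ _ (.of_forall fun z _ hz => dif_pos hz)
    · rw [stalkEnd_smulEnd_eq_zero hP (hρ i) hy, AddMonoidHom.zero_apply,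
        ← map_zero (germ (X := TopCat.of X) (P := P) (U := ⊤) (y : X) trivial)]
      refine germ_congr (X := TopCat.of X) _ _ ?_
      filter_upwards [(isClosed_tsupport fun y => (ρ i y : ℂ)).isOpen_compl.mem_nhds hy] with z hz _ _
      exact hzero i _ hz
  have hsum : ∀ (I : Finset (Option K)) (y : (⊤ : Opens X)),
      (∀ i, (y : X) ∈ tsupport (fun y => (ρ i y : ℂ)) → i ∈ I) → ∑ᶠ i, e i y = ∑ i ∈ I, e i y :=
    fun I y hy => finsum_eq_sum_of_support_subset _ fun i hi => hy i <| by
      by_contra h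
      exact hi (hzero i y h)
  have hmem : (fun y => ∑ᶠ i, e i y) ∈ P.sections ⊤ := by
    refine P.mem_sections_of_local fun x _ => ?_
    obtain ⟨I, hI⟩ := exists_finset_tsupport ρ x
    obtain ⟨N, hN, hNo, hxN⟩ := eventually_nhds_iff.1 hI
    refine ⟨⟨N, hNo⟩, le_top, hxN, ?_⟩
    have h1 : (fun y : (⟨N, hNo⟩ : Opens X) => ∑ᶠ i, e i ⟨y, trivial⟩) =
        fun y : (⟨N, hNo⟩ : Opens X) => (∑ i ∈ I, e i) ⟨y, trivial⟩ := funext fun y => by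
      rw [hsum I _ (hN y y.2), Finset.sum_apply]
    exact h1 ▸ P.res_mem_sections (U := (⊤ : Opens X)) (V := ⟨N, hNo⟩) le_top
      (sum_mem fun i _ => he i)
  refine ⟨(⟨_, hmem⟩ : P.sections ⊤), fun y => ?_⟩
  obtain ⟨I, hI⟩ := exists_finset_tsupport ρ (y : X)
  calc germ (X := TopCat.of X) (U := ⊤) (y : X) trivial ⟨_, hmem⟩
      = germ (X := TopCat.of X) (U := ⊤) (y : X) trivial (∑ i ∈ I, ⟨e i, he i⟩) := by
        refine germ_congr (X := TopCat.of X) _ _ ?_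
        filter_upwards [hI] with z hz _ _
        rw [AddSubmonoidClass.coe_finsetSum, Finset.sum_apply]
        exact hsum I _ hz
    _ = ∑ i ∈ I, P.sheaf.stalkEnd (smulEnd hP _ (hρ i)) (y : X) (s y) := by
        rw [map_sum]
        exact Finset.sum_congr rfl fun i _ => hgerm i y
    _ = s y := sum_stalkEnd_smulEnd ρ hP hρ (s y) hI

end

/-! ### Extendable tensors and forms -/

/-- The multiplier is absorbed into the smooth coefficient `c`, leaving the holomorphic factors
untouched. -/
theorem smoothStable_formGenerators (p : ℕ) : 𝒳.SmoothStable (𝒳.formGenerators p) := by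
  rintro f hf V s ⟨c, hc, g, hg, hs⟩
  refine ⟨fun y => f y * c y, fun y hy => (hf y).mul (hc y hy), g, hg, fun y => ?_⟩
  refine (congrArg (smoothGerm f (hf y) • ·) (hs y)).trans ?_
  exact TensorProduct.smul_tmul' (smoothGerm f (hf y)) _ _

theorem smoothStable_tensorGenerators (N N' : ℕ) : 𝒳.SmoothStable (𝒳.tensorGenerators N N') := by
  rintro f hf V s ⟨c, hc, g, hg, v, hv, hs⟩
  refine ⟨fun y => f y * c y, fun y hy => (hf y).mul (hc y hy), g, hg, v, hv, fun y => ?_⟩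
  refine (congrArg (smoothGerm f (hf y) • ·) (hs y)).trans ?_
  exact TensorProduct.smul_tmul' (smoothGerm f (hf y)) _ _

theorem isFine_isSoft_tensorSheaf [T2Space X] [SecondCountableTopology X] (N N' : ℕ) :
    (𝒳.tensorSheaf N N').IsFine ∧ (𝒳.tensorSheaf N N').IsSoft :=
  have h := smoothStable_tensorGenerators (𝒳 := 𝒳) N N'
  ⟨h.isFine, h.isSoft⟩

theorem isFine_isSoft_formSheaf [T2Space X] [SecondCountableTopology X] (p : ℕ) :
    (𝒳.formSheaf p).IsFine ∧ (𝒳.formSheaf p).IsSoft :=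
  have h := smoothStable_formGenerators (𝒳 := 𝒳) p
  ⟨h.isFine, h.isSoft⟩

/-- A smooth function on `X` is an extendable `0`-form. -/
theorem isExtendableZeroForm_of_smooth {f : X → ℂ} (hf : ∀ x, 𝒳.SmoothAt f x) :
    𝒳.IsExtendableZeroForm f := by
  -- One formula for every open set makes the section over `X'` the restriction of the global one by
  -- definition.
  let t : ∀ U : Opens X, ∀ y : U, 𝒳.FormStalk 0 y := fun _ y => smoothGerm f (hf y) ⊗ₜ[𝒳.O (y : X)]
    exteriorPower.ιMulti (𝒳.O (y : X)) 0 Fin.elim0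
  have ht : ∀ U, t U ∈ (𝒳.formGenerators 0).sections U := fun U =>
    mem_sections_of_mem_gen (X := TopCat.of X) _ ⟨f, fun y _ => hf y, Fin.elim0, fun j => j.elim0,
      fun y => congrArg (smoothGerm f (hf y) ⊗ₜ[𝒳.O (y : X)] ·) (congrArg _ (Subsingleton.elim _ _))⟩
  exact ⟨⟨_, ht _⟩, ⟨⟨_, ht _⟩, fun _ => rfl⟩, fun y => ⟨hf y, rfl⟩⟩

end AnalyticVariety

/-! ### The main theorem -/

theorem mainTheorem9 {n : ℕ} {X : Type u} [TopologicalSpace X] [T2Space X]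
    [SecondCountableTopology X] (𝒳 : AnalyticVariety n X) :
    (∀ {ι : Type*} (B : ι → AnalyticChart X), 𝒳.IsAtlas B →
      (∀ β, {γ | (closure ((B γ).A : Set X) ∩ ((B β).A : Set X)).Nonempty}.Finite) →
      ∃ ρ : PartitionOfUnity ι X, ρ.IsSubordinate (fun β => ((B β).A : Set X)) ∧
        (∀ β γ, ∃ R : (Fin (B γ).m → ℂ) → ℝ, ContDiffOn ℝ ∞ R (B γ).U ∧
          ∀ w : (B γ).W, R w = ρ β ((B γ).F.symm w)) ∧
        ∀ β, 𝒳.IsExtendableZeroForm fun x => (ρ β x : ℂ)) ∧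
    (∀ N N' : ℕ, (𝒳.tensorSheaf N N').IsFine ∧ (𝒳.tensorSheaf N N').IsSoft) ∧
    ∀ p : ℕ, (𝒳.formSheaf p).IsFine ∧ (𝒳.formSheaf p).IsSoft := by
  refine ⟨fun B hB _ => ?_, AnalyticVariety.isFine_isSoft_tensorSheaf,
    AnalyticVariety.isFine_isSoft_formSheaf⟩
  obtain ⟨ρ, hρB, hρ⟩ := 𝒳.exists_smooth_partitionOfUnity (fun β => (B β).A) hB.2
  exact ⟨ρ, hρB,
    -- The charts `B γ` belong only to the maximal atlas, so smoothness is first carried over to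
    -- them from the defining charts.
    fun β γ => AnalyticVariety.exists_contDiffOn_extension fun x => (hρ β x).chart (hB.1 γ),
    fun β => AnalyticVariety.isExtendableZeroForm_of_smooth (hρ β)⟩
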